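/- Let $\alpha\in(2/3,1)$ and let $b\neq0$ be real. Consider the Jacobi matrix with off-diagonal entries $a_n=n^\alpha$ $(n\ge1)$ and diagonal entries $b_n=b\,n^\alpha$ for odd $n$, $b_n=0$ for even $n$. Let $\lambda>0$. Then the complex vector space of sequences $(u_n)_{n\ge1}$ satisfying $$a_{n-1}u_{n-1}+b_nu_n+a_nu_{n+1}=\lambda u_n,\qquad n\ge2,$$ has a basis $u^+,u^-$ such that, as $n\to\infty$, $$u^\pm_{2n}\sim(-1)^n n^{-\alpha/4}\exp\Bigl(\pm\sqrt{\tfrac{b\lambda}{2^\alpha}}\;\frac{n^{1-\alpha/2}}{1-\alpha/2}\Bigr),$$ $$u^\pm_{2n+1}\sim\pm\sqrt{\tfrac{\lambda}{2^\alpha b}}\;(-1)^n n^{-3\alpha/4}\exp\Bigl(\pm\sqrt{\tfrac{b\lambda}{2^\alpha}}\;\frac{n^{1-\alpha/2}}{1-\alpha/2}\Bigr).$$ Here $x_n\sim y_n$ means $x_n=(1+o(1))\,y_n$, and the two (complex, if $b<0$) square roots are any choice with $\sqrt{b\lambda/2^\alpha}=b\,\sqrt{\lambda/(2^\alpha b)}$;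 for $b>0$ one may take both to be the positive square roots. -/

import Mathlib

open Filter Asymptotics

noncomputable section

/-- The off-diagonal entries (weights) `a_n = n ^ α`, `n ≥ 1`, of the Jacobi matrix. -/
def jacobiWeight (α : ℝ) (n : ℕ+) : ℝ := ((n : ℕ) : ℝ) ^ α

/-- The diagonal entries of the Jacobi matrix: `b * n ^ α` for odd `n`, and `0` for even `n`. -/
def jacobiDiagonal (α b : ℝ) (n : ℕ+) : ℝ :=
  if Odd (n : ℕ) then b * ((n : ℕ) : ℝ) ^ α else 0

/-- The complex vector space of sequences `(u_n)`, `n ≥ 1`, that satisfy the spectral recurrence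
`a_{m-1} u_{m-1} + b_m u_m + a_m u_{m+1} = lam * u_m` for all `m ≥ 2`.
Here `m = n + 1` with `n ≥ 1`. -/
def spectralSolutions (α b lam : ℝ) : Submodule ℂ (ℕ+ → ℂ) where
  carrier := {u | ∀ n : ℕ+,
    (jacobiWeight α n : ℂ) * u n + (jacobiDiagonal α b (n + 1) : ℂ) * u (n + 1)
      + (jacobiWeight α (n + 1) : ℂ) * u (n + 2) = (lam : ℂ) * u (n + 1)}
  zero_mem' := by intro n; simp
  add_mem' := by
    intro u v hu hv n
    have h1 := hu n
    have h2 := hv n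
    simp only [Pi.add_apply]
    linear_combination h1 + h2
  smul_mem' := by
    intro c u hu n
    have h1 := hu n
    simp only [Pi.smul_apply, smul_eq_mul]
    linear_combination c * h1

end

/-!
Put `x n = (-1) ^ n * U (2 * n)` and `y n = (-1) ^ n * U (2 * n + 1)`. The recurrence at two
consecutive indices becomes a first-order planar system, close to `x' - x = b * y`,
`y' - y = lam / (2 * n) ^ α * x`, whose WKB solutions have `x` of size `n ^ (-α / 4)`, `y` of size
`n ^ (-3 * α / 4)` and phase `β * n ^ (1 - α / 2) / (1 - α / 2)`. Dividing `x` and `y` by these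
amplitudes gives variables `X`, `Y` (`IsSpectralSeq.wkb_recurrence`) with
`X' = (1 - δ) X + ε Y`, `Y' = (1 + δ) Y + ε X'` up to small errors, where `ε = β * n ^ (-α / 2)` and
`δ = α / (4 * n)`.

Neither `δ` nor `ε ^ 2` is summable, so the obvious coordinates `X ± Y` are not good enough.
With `Z = Y - s X`, `s = ε / 2 + δ / ε`, the system for `(X, Z)` is symmetric with constant diagonal
up to errors of order `n ^ (-3 * α / 2)`, so that `X ± Z` decouple with multipliers
`1 ± ε + ε ^ 2 / 2`, and these agree with the increments of the exponentials to the same order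
(`ApproxDiagonalizable`, `approxDiagonalizable_wkb`). The errors are summable exactly because
`α > 2 / 3`.

It remains to perturb a diagonal planar recurrence by a summable term, a discrete case of Levinson's
theorem (`exists_solvesFrom_tendsto`): where the other exponential does not decay relative to the
chosen one, the solution is constructed from infinity by a contraction; where it decays to zero, by
forward iteration. One of the two applies according to the sign of the real part of `β`, so real and
imaginary `β` need no separate treatment. The result for `(β, κ)` and `(-β, -κ)` gives the two
solutions. Their Casoratian is asymptotic to `-2 * κ * n ^ (-α)`, hence nonzero somewhere, and since
a solution is determined by two initial values they form a basis (`basis_of_det_ne_zero`).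
-/

open Filter Topology Asymptotics

/-! ### Perturbation of a diagonal recurrence by a summable term -/

/-- `(p, q)` solves, for all indices `≥ N`, the planar recurrence whose unperturbed part is
diagonal, with solutions `(1, 0)` and `(0, E)`, and whose perturbation is the matrix `r`. -/
def SolvesFrom (E r₁₁ r₁₂ r₂₁ r₂₂ p q : ℕ → ℂ) (N : ℕ) : Prop :=
  ∀ n, N ≤ n → p (n + 1) = p n + r₁₁ n * p n + r₁₂ n * q n ∧
    q (n + 1) = E (n + 1) / E n * q n + r₂₁ n * p n + r₂₂ n * q n

lemma norm_lin_le {a b x y : ℂ} {s C : ℝ} (h : ‖a‖ + ‖b‖ ≤ s) (hx : ‖x‖ ≤ C) (hy : ‖y‖ ≤ C) :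
    ‖a * x + b * y‖ ≤ s * C := by
  have hC : 0 ≤ C := (norm_nonneg x).trans hx
  calc ‖a * x + b * y‖ ≤ ‖a‖ * ‖x‖ + ‖b‖ * ‖y‖ := by
        simpa only [norm_mul] using norm_add_le (a * x) (b * y)
    _ ≤ ‖a‖ * C + ‖b‖ * C := by gcongr
    _ = (‖a‖ + ‖b‖) * C := by ring
    _ ≤ s * C := by gcongr

/-- If `|E|` is monotone, the solution close to `(1, 0)` is obtained by summing the perturbation
from infinity: it is the fixed point of a contraction of the space of bounded sequences. -/
lemma exists_solvesFrom_zero_of_monotone {E r₁₁ r₁₂ r₂₁ r₂₂ : ℕ → ℂ} {r : ℕ → ℝ}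
    (hE0 : ∀ n, E n ≠ 0) (hE : Monotone fun n => ‖E n‖)
    (h₁ : ∀ n, ‖r₁₁ n‖ + ‖r₁₂ n‖ ≤ r n) (h₂ : ∀ n, ‖r₂₁ n‖ + ‖r₂₂ n‖ ≤ r n)
    (hr : Summable r) (hsum : ∑' n, r n ≤ 1 / 4) :
    ∃ p q : ℕ → ℂ, SolvesFrom E r₁₁ r₁₂ r₂₁ r₂₂ p q 0 ∧
      Tendsto p atTop (𝓝 1) ∧ Tendsto q atTop (𝓝 0) := by
  have hr0 : ∀ n, 0 ≤ r n := fun n => (by positivity : (0 : ℝ) ≤ _).trans (h₁ n)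
  have hrs : ∀ n, Summable fun k => r (k + n) := fun n => (summable_nat_add_iff n).2 hr
  have htail : ∀ n, ∑' k, r (k + n) ≤ 1 / 4 := fun n => by
    have := hr.sum_add_tsum_nat_add n
    have h0 : 0 ≤ ∑ i ∈ Finset.range n, r i := Finset.sum_nonneg fun i _ => hr0 i
    linarith
  have hEle : ∀ n k, ‖E n / E (n + k + 1)‖ ≤ 1 := fun n k => by
    rw [norm_div]
    exact div_le_one_of_le₀ (hE (by omega)) (norm_nonneg _)
  let F : (ℕ → ℂ × ℂ) → ℕ → ℕ → ℂ := fun d n k =>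
    r₁₁ (k + n) * (d (k + n)).1 + r₁₂ (k + n) * (d (k + n)).2
  let G : (ℕ → ℂ × ℂ) → ℕ → ℕ → ℂ := fun d n k =>
    E n / E (n + k + 1) * (r₂₁ (k + n) * (d (k + n)).1 + r₂₂ (k + n) * (d (k + n)).2)
  have hFb : ∀ (d : ℕ → ℂ × ℂ) (C : ℝ), (∀ n, ‖d n‖ ≤ C) → ∀ n k, ‖F d n k‖ ≤ r (k + n) * C :=
    fun d C hd n k => norm_lin_le (h₁ _) ((norm_fst_le _).trans (hd _))
      ((norm_snd_le _).trans (hd _))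
  have hGb : ∀ (d : ℕ → ℂ × ℂ) (C : ℝ), (∀ n, ‖d n‖ ≤ C) → ∀ n k, ‖G d n k‖ ≤ r (k + n) * C :=
    fun d C hd n k => by
      have := norm_lin_le (h₂ (k + n)) ((norm_fst_le _).trans (hd (k + n)))
        ((norm_snd_le _).trans (hd (k + n)))
      calc ‖G d n k‖ ≤ 1 * (r (k + n) * C) := by
            rw [norm_mul]; exact mul_le_mul (hEle n k) this (norm_nonneg _) zero_le_one
        _ = _ := one_mul _
  have hFs : ∀ (d : ℕ → ℂ × ℂ) (C : ℝ), (∀ n, ‖d n‖ ≤ C) → ∀ n, Summable (F d n) :=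
    fun d C hd n => ((hrs n).mul_right C).of_norm_bounded (hFb d C hd n)
  have hGs : ∀ (d : ℕ → ℂ × ℂ) (C : ℝ), (∀ n, ‖d n‖ ≤ C) → ∀ n, Summable (G d n) :=
    fun d C hd n => ((hrs n).mul_right C).of_norm_bounded (hGb d C hd n)
  have hFt : ∀ (d : ℕ → ℂ × ℂ) (C : ℝ), (∀ n, ‖d n‖ ≤ C) → ∀ n,
      ‖∑' k, F d n k‖ ≤ (∑' k, r (k + n)) * C := fun d C hd n => by
    rw [← tsum_mul_right]
    exact tsum_of_norm_bounded ((hrs n).mul_right C).hasSum (hFb d C hd n)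
  have hGt : ∀ (d : ℕ → ℂ × ℂ) (C : ℝ), (∀ n, ‖d n‖ ≤ C) → ∀ n,
      ‖∑' k, G d n k‖ ≤ (∑' k, r (k + n)) * C := fun d C hd n => by
    rw [← tsum_mul_right]
    exact tsum_of_norm_bounded ((hrs n).mul_right C).hasSum (hGb d C hd n)
  let T : (ℕ → ℂ × ℂ) → ℕ → ℂ × ℂ := fun d n => (1 - ∑' k, F d n k, - ∑' k, G d n k)
  have hTb : ∀ (d : ℕ → ℂ × ℂ) (C : ℝ), (∀ n, ‖d n‖ ≤ C) → ∀ n, ‖T d n‖ ≤ 1 + 1 / 4 * C := by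
    intro d C hd n
    have hC : 0 ≤ C := (norm_nonneg _).trans (hd 0)
    have hm : (∑' k, r (k + n)) * C ≤ 1 / 4 * C := mul_le_mul_of_nonneg_right (htail n) hC
    refine norm_prod_le_iff.2 ⟨?_, ?_⟩
    · refine (norm_sub_le _ _).trans ?_
      rw [norm_one]
      linarith [hFt d C hd n]
    · simp only [T, norm_neg]
      linarith [hGt d C hd n]
  let Φ : BoundedContinuousFunction ℕ (ℂ × ℂ) → BoundedContinuousFunction ℕ (ℂ × ℂ) := fun d =>
    BoundedContinuousFunction.ofNormedAddCommGroupDiscrete (T d) (1 + 1 / 4 * ‖d‖)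
      (hTb d ‖d‖ d.norm_coe_le_norm)
  -- The factor `1 / 4` bounds every tail of the series of `r`.
  have hΦ : ContractingWith (1 / 4) Φ := by
    refine ⟨by rw [← NNReal.coe_lt_coe]; norm_num, LipschitzWith.of_dist_le_mul fun d e => ?_⟩
    have hde : ∀ n, ‖(d - e) n‖ ≤ dist d e := fun n => by
      rw [dist_eq_norm]; exact (d - e).norm_coe_le_norm n
    have hm : ∀ n, (∑' k, r (k + n)) * dist d e ≤ 1 / 4 * dist d e := fun n =>
      mul_le_mul_of_nonneg_right (htail n) dist_nonneg
    have hFsub : ∀ n, ∑' k, F d n k - ∑' k, F e n k = ∑' k, F ⇑(d - e) n k := fun n => by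
      rw [← (hFs d _ d.norm_coe_le_norm n).tsum_sub (hFs e _ e.norm_coe_le_norm n)]
      refine tsum_congr fun k => ?_
      simp only [F, BoundedContinuousFunction.coe_sub, Pi.sub_apply, Prod.fst_sub, Prod.snd_sub]
      ring
    have hGsub : ∀ n, ∑' k, G d n k - ∑' k, G e n k = ∑' k, G ⇑(d - e) n k := fun n => by
      rw [← (hGs d _ d.norm_coe_le_norm n).tsum_sub (hGs e _ e.norm_coe_le_norm n)]
      refine tsum_congr fun k => ?_
      simp only [G, BoundedContinuousFunction.coe_sub, Pi.sub_apply, Prod.fst_sub, Prod.snd_sub]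
      ring
    push_cast
    refine (BoundedContinuousFunction.dist_le (by positivity)).2 fun n => ?_
    rw [dist_eq_norm]
    refine norm_prod_le_iff.2 ⟨?_, ?_⟩
    · have : (Φ d n - Φ e n).1 = -∑' k, F ⇑(d - e) n k := by
        rw [← hFsub]; change (1 - _) - (1 - _) = _; ring
      rw [this, norm_neg]
      exact (hFt _ _ hde n).trans (hm n)
    · have : (Φ d n - Φ e n).2 = -∑' k, G ⇑(d - e) n k := by
        rw [← hGsub]; change (- _) - (- _) = _; ring
      rw [this, norm_neg]
      exact (hGt _ _ hde n).trans (hm n)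
  obtain ⟨d, hd⟩ : ∃ d, Φ d = d := ⟨_, hΦ.fixedPoint_isFixedPt⟩
  have hdn : ∀ n, d n = (1 - ∑' k, F d n k, - ∑' k, G d n k) := fun n =>
    (congrArg (fun f : BoundedContinuousFunction ℕ (ℂ × ℂ) => f n) hd).symm
  have hp : ∀ n, (d n).1 = 1 - ∑' k, F d n k := fun n => congrArg Prod.fst (hdn n)
  have hq : ∀ n, (d n).2 = - ∑' k, G d n k := fun n => congrArg Prod.snd (hdn n)
  have hlim : Tendsto (fun n => (∑' k, r (k + n)) * ‖d‖) atTop (𝓝 0) := by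
    simpa using (tendsto_sum_nat_add r).mul_const ‖d‖
  refine ⟨fun n => (d n).1, fun n => (d n).2, fun n _ => ⟨?_, ?_⟩, ?_, ?_⟩
  · have h := (hFs d _ d.norm_coe_le_norm n).tsum_eq_zero_add
    have e1 : ∀ k, F d n (k + 1) = F d (n + 1) k := fun k => by
      simp only [F, show k + 1 + n = k + (n + 1) by ring]
    have e0 : F d n 0 = r₁₁ n * (d n).1 + r₁₂ n * (d n).2 := by simp [F]
    simp only [e1, e0] at h
    have hpn := hp n
    have hpn1 := hp (n + 1)
    simp only
    linear_combination hpn1 - hpn + h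
  · have h := (hGs d _ d.norm_coe_le_norm n).tsum_eq_zero_add
    have e1 : ∀ k, G d n (k + 1) = E n / E (n + 1) * G d (n + 1) k := fun k => by
      simp only [G, show k + 1 + n = k + (n + 1) by ring,
        show n + (k + 1) + 1 = n + 1 + k + 1 by ring]
      have := hE0 (n + 1)
      field_simp
    have e0 : G d n 0 = E n / E (n + 1) * (r₂₁ n * (d n).1 + r₂₂ n * (d n).2) := by simp [G]
    simp only [e1, e0, tsum_mul_left] at h
    have hqn := hq n
    have hqn1 := hq (n + 1)
    have hEE : E (n + 1) / E n * (E n / E (n + 1)) = 1 := by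
      have := hE0 n; have := hE0 (n + 1); field_simp
    simp only
    linear_combination hqn1 - E (n + 1) / E n * hqn + E (n + 1) / E n * h +
      (r₂₁ n * (d n).1 + r₂₂ n * (d n).2 + ∑' k, G d (n + 1) k) * hEE
  · rw [tendsto_iff_norm_sub_tendsto_zero]
    refine squeeze_zero (fun _ => norm_nonneg _) (fun n => ?_) hlim
    rw [hp n, show (1 - ∑' k, F d n k - 1 : ℂ) = -∑' k, F d n k by ring, norm_neg]
    exact hFt d _ d.norm_coe_le_norm n
  · refine squeeze_zero_norm (fun n => ?_) hlim
    rw [hq n, norm_neg]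
    exact hGt d _ d.norm_coe_le_norm n

/-- If `|E|` decreases to `0`, a forward iteration suffices: every solution has a
convergent first and a vanishing second component; starting from `(1, 0)` the first limit is
nonzero and can be normalised. -/
lemma exists_solvesFrom_zero_of_antitone {E r₁₁ r₁₂ r₂₁ r₂₂ : ℕ → ℂ} {r : ℕ → ℝ}
    (hE0 : ∀ n, E n ≠ 0) (hE : Antitone fun n => ‖E n‖) (hElim : Tendsto E atTop (𝓝 0))
    (h₁ : ∀ n, ‖r₁₁ n‖ + ‖r₁₂ n‖ ≤ r n) (h₂ : ∀ n, ‖r₂₁ n‖ + ‖r₂₂ n‖ ≤ r n)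
    (hr : Summable r) (hsum : ∑' n, r n ≤ 1 / 4) :
    ∃ p q : ℕ → ℂ, SolvesFrom E r₁₁ r₁₂ r₂₁ r₂₂ p q 0 ∧
      Tendsto p atTop (𝓝 1) ∧ Tendsto q atTop (𝓝 0) := by
  have hr0 : ∀ n, 0 ≤ r n := fun n => (by positivity : (0 : ℝ) ≤ _).trans (h₁ n)
  let d : ℕ → ℂ × ℂ := fun n => Nat.rec (1, 0) (fun n d =>
    (d.1 + r₁₁ n * d.1 + r₁₂ n * d.2, E (n + 1) / E n * d.2 + r₂₁ n * d.1 + r₂₂ n * d.2)) n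
  have hp : ∀ n, (d (n + 1)).1 = (d n).1 + (r₁₁ n * (d n).1 + r₁₂ n * (d n).2) := fun n =>
    add_assoc _ _ _
  have hq : ∀ n, (d (n + 1)).2 =
      E (n + 1) / E n * (d n).2 + (r₂₁ n * (d n).1 + r₂₂ n * (d n).2) := fun n =>
    add_assoc _ _ _
  have hρ : ∀ n, ‖E (n + 1) / E n‖ ≤ 1 := fun n => by
    rw [norm_div]
    exact div_le_one_of_le₀ (hE (by omega)) (norm_nonneg _)
  have hpart : ∀ n, ∑ k ∈ Finset.range n, r k ≤ 1 / 4 := fun n =>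
    (hr.sum_le_tsum _ fun i _ => hr0 i).trans hsum
  -- The total perturbation `1 / 4` keeps `p` within `1 / 2` of `1`, hence away from `0`.
  have hbound : ∀ n, ‖(d n).1 - 1‖ ≤ 2 * ∑ k ∈ Finset.range n, r k ∧
      ‖(d n).2‖ ≤ 2 * ∑ k ∈ Finset.range n, r k := by
    intro n
    induction n with
    | zero => simp [d]
    | succ n ih =>
      have h1 : ‖(d n).1‖ ≤ 2 := by
        have := norm_add_le ((d n).1 - 1) 1
        rw [sub_add_cancel, norm_one] at this
        linarith [ih.1, hpart n]
      have h2 : ‖(d n).2‖ ≤ 2 := by linarith [ih.2, hpart n]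
      have hF := norm_lin_le (h₁ n) h1 h2
      have hG := norm_lin_le (h₂ n) h1 h2
      rw [Finset.sum_range_succ]
      constructor
      · rw [hp n, add_sub_right_comm]
        exact (norm_add_le _ _).trans (by linarith [ih.1])
      · rw [hq n]
        refine (norm_add_le _ _).trans ?_
        rw [norm_mul]
        have := mul_le_mul_of_nonneg_right (hρ n) (norm_nonneg (d n).2)
        linarith [ih.2]
  have hp2 : ∀ n, ‖(d n).1‖ ≤ 2 := fun n => by
    have := norm_add_le ((d n).1 - 1) 1
    rw [sub_add_cancel, norm_one] at this
    linarith [(hbound n).1, hpart n]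
  have hq2 : ∀ n, ‖(d n).2‖ ≤ 2 := fun n => by linarith [(hbound n).2, hpart n]
  obtain ⟨L, hL⟩ : ∃ L, Tendsto (fun n => (d n).1) atTop (𝓝 L) := by
    refine cauchySeq_tendsto_of_complete (cauchySeq_of_dist_le_of_summable (fun n => r n * 2)
      (fun n => ?_) (hr.mul_right 2))
    rw [dist_comm, dist_eq_norm, Nat.succ_eq_add_one, hp n, add_sub_cancel_left]
    exact norm_lin_le (h₁ n) (hp2 n) (hq2 n)
  have hL0 : L ≠ 0 := by
    rintro rfl
    have h : Tendsto (fun n => ‖(d n).1 - 1‖) atTop (𝓝 ‖(0 : ℂ) - 1‖) :=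
      (hL.sub_const 1).norm
    have := le_of_tendsto h (Eventually.of_forall fun n => (hbound n).1.trans
      (mul_le_mul_of_nonneg_left (hpart n) zero_le_two))
    norm_num at this
  -- The Duhamel sum for `q` split at `K`: the old part is damped by `E`, the new one is a tail.
  have hqE : ∀ K n, ‖(d (K + n)).2‖ ≤
      ‖E (K + n)‖ / ‖E K‖ * 2 + ∑ k ∈ Finset.range n, r (k + K) * 2 := by
    intro K n
    induction n with
    | zero => simpa [norm_ne_zero_iff.2 (hE0 K)] using hq2 K
    | succ n ih =>
      have hG := norm_lin_le (h₂ (K + n)) (hp2 (K + n)) (hq2 (K + n))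
      rw [← add_assoc, hq (K + n), Finset.sum_range_succ, add_comm n K]
      refine (norm_add_le _ _).trans ?_
      rw [norm_mul]
      have e1 : ‖E (K + n + 1) / E (K + n)‖ * (‖E (K + n)‖ / ‖E K‖ * 2) =
          ‖E (K + n + 1)‖ / ‖E K‖ * 2 := by
        rw [norm_div]
        have := norm_ne_zero_iff.2 (hE0 (K + n))
        field_simp
      have h0 : 0 ≤ ∑ k ∈ Finset.range n, r (k + K) * 2 :=
        Finset.sum_nonneg fun i _ => mul_nonneg (hr0 _) zero_le_two
      have e2 := mul_le_mul_of_nonneg_left ih (norm_nonneg (E (K + n + 1) / E (K + n)))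
      have e3 := mul_le_mul_of_nonneg_right (hρ (K + n)) h0
      rw [mul_add, e1] at e2
      linarith
  have hq0 : Tendsto (fun n => (d n).2) atTop (𝓝 0) := by
    rw [Metric.tendsto_atTop]
    intro ε hε
    have htl := (tendsto_sum_nat_add r).eventually (gt_mem_nhds (show (0 : ℝ) < ε / 4 by linarith))
    obtain ⟨K, hK⟩ := htl.exists
    have hEK : Tendsto (fun n => ‖E n‖ / ‖E K‖ * 2) atTop (𝓝 0) := by
      simpa using (hElim.norm.div_const ‖E K‖).mul_const 2
    obtain ⟨M, hM⟩ := eventually_atTop.1 (hEK.eventually (gt_mem_nhds (half_pos hε)))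
    refine ⟨max K M, fun n hn => ?_⟩
    obtain ⟨m, rfl⟩ := Nat.exists_eq_add_of_le ((le_max_left K M).trans hn)
    have h1 := hM _ ((le_max_right K M).trans hn)
    have h2 : ∑ k ∈ Finset.range m, r (k + K) ≤ ∑' k, r (k + K) :=
      ((summable_nat_add_iff K).2 hr).sum_le_tsum _ fun i _ => hr0 _
    have h3 := hqE K m
    rw [← Finset.sum_mul] at h3
    rw [dist_zero_right]
    linarith
  refine ⟨fun n => (d n).1 / L, fun n => (d n).2 / L, fun n _ => ⟨?_, ?_⟩, ?_, ?_⟩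
  · simp only [hp n]; ring
  · simp only [hq n]; ring
  · simpa [hL0] using hL.div_const L
  · simpa using hq0.div_const L

/-- A planar case of Levinson's theorem: a summable perturbation of a diagonal recurrence whose
second solution `(0, E)` has nondecreasing modulus, or decreases to zero, keeps a solution
asymptotic to the constant solution `(1, 0)`. -/
lemma exists_solvesFrom_tendsto {E r₁₁ r₁₂ r₂₁ r₂₂ : ℕ → ℂ} (hE0 : ∀ n, E n ≠ 0)
    (hE : (Monotone fun n => ‖E n‖) ∨ ((Antitone fun n => ‖E n‖) ∧ Tendsto E atTop (𝓝 0)))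
    (h₁₁ : Summable fun n => ‖r₁₁ n‖) (h₁₂ : Summable fun n => ‖r₁₂ n‖)
    (h₂₁ : Summable fun n => ‖r₂₁ n‖) (h₂₂ : Summable fun n => ‖r₂₂ n‖) :
    ∃ N, 1 ≤ N ∧ ∃ p q : ℕ → ℂ, SolvesFrom E r₁₁ r₁₂ r₂₁ r₂₂ p q N ∧
      Tendsto p atTop (𝓝 1) ∧ Tendsto q atTop (𝓝 0) := by
  let r : ℕ → ℝ := fun n => ‖r₁₁ n‖ + ‖r₁₂ n‖ + (‖r₂₁ n‖ + ‖r₂₂ n‖)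
  have hr : Summable r := (h₁₁.add h₁₂).add (h₂₁.add h₂₂)
  obtain ⟨N, hN, hN1⟩ := (((tendsto_sum_nat_add r).eventually
    (gt_mem_nhds (show (0 : ℝ) < 1 / 4 by norm_num))).and (eventually_ge_atTop 1)).exists
  have hrN : Summable fun n => r (n + N) := (summable_nat_add_iff N).2 hr
  have h₁ : ∀ n, ‖r₁₁ (n + N)‖ + ‖r₁₂ (n + N)‖ ≤ r (n + N) := fun n =>
    le_add_of_nonneg_right (by positivity)
  have h₂ : ∀ n, ‖r₂₁ (n + N)‖ + ‖r₂₂ (n + N)‖ ≤ r (n + N) := fun n =>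
    le_add_of_nonneg_left (by positivity)
  obtain ⟨p, q, hs, hp, hq⟩ : ∃ p q : ℕ → ℂ, SolvesFrom (fun n => E (n + N))
      (fun n => r₁₁ (n + N)) (fun n => r₁₂ (n + N)) (fun n => r₂₁ (n + N))
      (fun n => r₂₂ (n + N)) p q 0 ∧ Tendsto p atTop (𝓝 1) ∧ Tendsto q atTop (𝓝 0) := by
    rcases hE with hE | ⟨hE, hlim⟩
    · exact exists_solvesFrom_zero_of_monotone (fun n => hE0 _)
        (fun a b hab => hE (by omega : a + N ≤ b + N)) h₁ h₂ hrN hN.le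
    · exact exists_solvesFrom_zero_of_antitone (fun n => hE0 _)
        (fun a b hab => hE (by omega : a + N ≤ b + N))
        (hlim.comp (tendsto_add_atTop_nat N)) h₁ h₂ hrN hN.le
  refine ⟨N, hN1, fun n => p (n - N), fun n => q (n - N), fun n hn => ?_,
    hp.comp (tendsto_sub_atTop_nat N), hq.comp (tendsto_sub_atTop_nat N)⟩
  have := hs (n - N) (Nat.zero_le _)
  simpa [Nat.sub_add_cancel hn, Nat.sub_add_comm hn, add_right_comm] using this

/-! ### The space of solutions of the spectral recurrence -/

/-- The recurrence defining `spectralSolutions`, for sequences indexed by `ℕ` whose value at `0`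
is irrelevant. -/
def IsSpectralSeq (α b lam : ℝ) (U : ℕ → ℂ) : Prop :=
  ∀ k : ℕ, 1 ≤ k → (((k : ℝ) ^ α : ℝ) : ℂ) * U k
    + ((if Odd (k + 1) then b * ((k + 1 : ℕ) : ℝ) ^ α else 0 : ℝ) : ℂ) * U (k + 1)
    + ((((k + 1 : ℕ) : ℝ) ^ α : ℝ) : ℂ) * U (k + 2) = (lam : ℂ) * U (k + 1)

lemma mem_spectralSolutions_iff {α b lam : ℝ} {u : ℕ+ → ℂ} :
    u ∈ spectralSolutions α b lam ↔ IsSpectralSeq α b lam (fun k => u k.toPNat') := by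
  constructor
  · intro hu k hk
    obtain ⟨j, rfl⟩ := Nat.exists_eq_add_of_le' hk
    exact hu j.succPNat
  · intro hu n
    have h := hu n n.pos
    have e1 : ((n : ℕ) + 1).toPNat' = n + 1 := by
      rw [← PNat.coe_inj, Nat.toPNat'_coe]; simp
    have e2 : ((n : ℕ) + 2).toPNat' = n + 2 := by
      rw [← PNat.coe_inj, Nat.toPNat'_coe]; simp
    simp only [PNat.coe_toPNat', e1, e2] at h
    exact h

lemma natCast_rpow_ne_zero (α : ℝ) {k : ℕ} (hk : 1 ≤ k) : (((k : ℝ) ^ α : ℝ) : ℂ) ≠ 0 := by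
  have : (0 : ℝ) < k := by exact_mod_cast hk
  exact_mod_cast (Real.rpow_pos_of_pos this α).ne'

lemma exists_isSpectralSeq_one (α b lam : ℝ) (v w : ℂ) :
    ∃ U, IsSpectralSeq α b lam U ∧ U 1 = v ∧ U 2 = w := by
  let d : ℕ → ℂ × ℂ := fun n => Nat.rec (v, w) (fun j d => (d.2,
    ((lam : ℂ) * d.2 - (((j + 1 : ℕ) : ℝ) ^ α : ℝ) * d.1 -
      ((if Odd (j + 1 + 1) then b * ((j + 1 + 1 : ℕ) : ℝ) ^ α else 0 : ℝ) : ℂ) * d.2) /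
      ((((j + 1 + 1 : ℕ) : ℝ) ^ α : ℝ) : ℂ))) n
  refine ⟨fun k => (d (k - 1)).1, fun k hk => ?_, rfl, rfl⟩
  obtain ⟨j, rfl⟩ := Nat.exists_eq_add_of_le' hk
  have h0 := natCast_rpow_ne_zero α (show 1 ≤ j + 1 + 1 by omega)
  have h1 : (d (j + 1)).1 = (d j).2 := rfl
  have h2 : (d (j + 1 + 1)).1 = ((lam : ℂ) * (d j).2 - (((j + 1 : ℕ) : ℝ) ^ α : ℝ) * (d j).1 -
      ((if Odd (j + 1 + 1) then b * ((j + 1 + 1 : ℕ) : ℝ) ^ α else 0 : ℝ) : ℂ) * (d j).2) /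
      ((((j + 1 + 1 : ℕ) : ℝ) ^ α : ℝ) : ℂ) := rfl
  rw [eq_div_iff h0] at h2
  simp only [show j + 1 - 1 = j by omega, show j + 1 + 1 - 1 = j + 1 by omega,
    show j + 1 + 2 - 1 = j + 1 + 1 by omega, h1]
  linear_combination h2

/-- The recurrence can be solved in both directions, its off-diagonal coefficients being nonzero. -/
lemma exists_isSpectralSeq (α b lam : ℝ) {N : ℕ} (hN : 1 ≤ N) (v w : ℂ) :
    ∃ U, IsSpectralSeq α b lam U ∧ U N = v ∧ U (N + 1) = w := by
  induction N, hN using Nat.le_induction generalizing v w with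
  | base => exact exists_isSpectralSeq_one α b lam v w
  | succ N hN ih =>
    have h0 := natCast_rpow_ne_zero α hN
    have h1 := natCast_rpow_ne_zero α (show 1 ≤ N + 1 by omega)
    obtain ⟨U, hU, hv, hw⟩ := ih (((lam : ℂ) * v -
      ((if Odd (N + 1) then b * ((N + 1 : ℕ) : ℝ) ^ α else 0 : ℝ) : ℂ) * v -
      ((((N + 1 : ℕ) : ℝ) ^ α : ℝ) : ℂ) * w) / (((N : ℝ) ^ α : ℝ) : ℂ)) v
    refine ⟨U, hU, hw, mul_left_cancel₀ h1 ?_⟩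
    rw [eq_div_iff h0] at hv
    have h := hU N hN
    rw [hw] at h
    show _ * U (N + 2) = _
    linear_combination h - hv

lemma IsSpectralSeq.eq_zero {α b lam : ℝ} {U : ℕ → ℂ} (hU : IsSpectralSeq α b lam U)
    (h1 : U 1 = 0) (h2 : U 2 = 0) {k : ℕ} (hk : 1 ≤ k) : U k = 0 ∧ U (k + 1) = 0 := by
  induction k, hk using Nat.le_induction with
  | base => exact ⟨h1, h2⟩
  | succ k hk ih =>
    refine ⟨ih.2, ?_⟩
    have h := hU k hk
    simpa [ih.1, ih.2, natCast_rpow_ne_zero α (show 1 ≤ k + 1 by omega), -Nat.cast_add] using h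

/-- The pair of the first two values of a solution, which determines it. -/
def initialValues (α b lam : ℝ) : spectralSolutions α b lam →ₗ[ℂ] (Fin 2 → ℂ) where
  toFun u := ![(u : ℕ+ → ℂ) 1, (u : ℕ+ → ℂ) 2]
  map_add' u v := by ext i; fin_cases i <;> simp
  map_smul' c u := by ext i; fin_cases i <;> simp

lemma initialValues_injective (α b lam : ℝ) : Function.Injective (initialValues α b lam) := by
  rw [injective_iff_map_eq_zero]
  intro u hu
  have hU := mem_spectralSolutions_iff.1 u.2
  have h1 : (u : ℕ+ → ℂ) 1 = 0 := congrFun hu 0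
  have h2 : (u : ℕ+ → ℂ) 2 = 0 := congrFun hu 1
  ext n
  simpa using (hU.eq_zero h1 h2 n.pos).1

/-- Two solutions whose values at one pair of consecutive indices are independent form a basis. -/
lemma basis_of_det_ne_zero {α b lam : ℝ} (u v : spectralSolutions α b lam) {m n : ℕ+}
    (h : (u : ℕ+ → ℂ) m * (v : ℕ+ → ℂ) n - (v : ℕ+ → ℂ) m * (u : ℕ+ → ℂ) n ≠ 0) :
    LinearIndependent ℂ ![u, v] ∧ Submodule.span ℂ {u, v} = ⊤ := by
  have hli : LinearIndependent ℂ ![u, v] := by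
    rw [LinearIndependent.pair_iff]
    intro s t hst
    have hm : s * (u : ℕ+ → ℂ) m + t * (v : ℕ+ → ℂ) m = 0 :=
      congrFun (congrArg Subtype.val hst) m
    have hn : s * (u : ℕ+ → ℂ) n + t * (v : ℕ+ → ℂ) n = 0 :=
      congrFun (congrArg Subtype.val hst) n
    exact ⟨(mul_eq_zero.1 (show s * _ = 0 by
        linear_combination (v : ℕ+ → ℂ) n * hm - (v : ℕ+ → ℂ) m * hn)).resolve_right h,
      (mul_eq_zero.1 (show t * _ = 0 by
        linear_combination (u : ℕ+ → ℂ) m * hn - (u : ℕ+ → ℂ) n * hm)).resolve_right h⟩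
  have hfin : Module.Finite ℂ (spectralSolutions α b lam) :=
    Module.Finite.of_injective _ (initialValues_injective α b lam)
  have hle := LinearMap.finrank_le_finrank_of_injective (initialValues_injective α b lam)
  have hge := hli.fintype_card_le_finrank
  simp only [Module.finrank_fin_fun, Fintype.card_fin] at hle hge
  have := hli.span_eq_top_of_card_eq_finrank (by simpa using le_antisymm hge hle)
  exact ⟨hli, by simpa [Matrix.range_cons, Set.pair_comm] using this⟩

/-! ### Asymptotic expansions of powers -/

lemma natCast_rpow_isBigO {a b : ℝ} (h : a ≤ b) :
    (fun n : ℕ => (((n : ℝ) ^ a : ℝ) : ℂ)) =O[atTop] fun n : ℕ => (n : ℝ) ^ b := by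
  refine IsBigO.of_bound 1 ?_
  filter_upwards [eventually_ge_atTop 1] with n hn
  have : (1 : ℝ) ≤ n := by exact_mod_cast hn
  rw [Complex.norm_real, one_mul, Real.norm_of_nonneg (by positivity),
    Real.norm_of_nonneg (by positivity)]
  exact Real.rpow_le_rpow_of_exponent_le this h

lemma isBigO_real_rpow_of_le {f : ℕ → ℂ} {a b : ℝ}
    (hf : f =O[atTop] fun n : ℕ => (n : ℝ) ^ a) (h : a ≤ b) :
    f =O[atTop] fun n : ℕ => (n : ℝ) ^ b := by
  refine hf.trans ?_
  have := (natCast_rpow_isBigO h).norm_left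
  simp only [Complex.norm_real] at this
  exact this.of_norm_left

/-- Products of power bounds. -/
lemma isBigO_real_rpow_mul {f h : ℕ → ℂ} {a b c : ℝ} (hf : f =O[atTop] fun n : ℕ => (n : ℝ) ^ a)
    (hh : h =O[atTop] fun n : ℕ => (n : ℝ) ^ b) (habc : a + b ≤ c) :
    (fun n => f n * h n) =O[atTop] fun n : ℕ => (n : ℝ) ^ c := by
  refine isBigO_real_rpow_of_le (a := a + b) ((hf.mul hh).congr' EventuallyEq.rfl ?_) habc
  filter_upwards [eventually_ge_atTop 1] with n hn
  have : (0 : ℝ) < n := by exact_mod_cast hn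
  rw [Real.rpow_add this]

lemma isBigO_one_mul {f h : ℕ → ℂ} {g : ℕ → ℝ} (hf : f =O[atTop] fun _ : ℕ => (1 : ℝ))
    (hh : h =O[atTop] g) : (fun n => f n * h n) =O[atTop] g := by
  simpa using hf.mul hh

lemma one_add_rpow_sub_isBigO (γ : ℝ) :
    (fun x : ℝ => (1 + x) ^ γ - (1 + γ * x)) =O[𝓝 0] fun x => x ^ 2 := by
  have h := (Real.one_add_rpow_hasFPowerSeriesAt_zero (a := γ)).isBigO_sub_partialSum_pow 2
  refine (h.congr_left fun x => ?_).trans (IsBigO.of_bound 1 (by simp))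
  simp [FormalMultilinearSeries.partialSum, Finset.sum_range_succ, binomialSeries,
    FormalMultilinearSeries.coeff_ofScalars, mul_comm]

lemma one_add_div_rpow_sub_isBigO (c γ : ℝ) :
    (fun n : ℕ => (((1 + c / n) ^ γ - (1 + γ * (c / n)) : ℝ) : ℂ)) =O[atTop]
      fun n : ℕ => (n : ℝ) ^ (-2 : ℝ) := by
  have ht : Tendsto (fun n : ℕ => c / (n : ℝ)) atTop (𝓝 0) :=
    tendsto_const_div_atTop_nhds_zero_nat c
  have h := (one_add_rpow_sub_isBigO γ).comp_tendsto ht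
  have h2 : (fun n : ℕ => (c / (n : ℝ)) ^ 2) =O[atTop] fun n : ℕ => (n : ℝ) ^ (-2 : ℝ) := by
    refine IsBigO.of_bound (c ^ 2) (Eventually.of_forall fun n => le_of_eq ?_)
    rw [Real.rpow_neg (Nat.cast_nonneg n)]
    simp [mul_pow, div_eq_mul_inv]
  refine IsBigO.of_norm_left ?_
  simp only [Complex.norm_real]
  exact (h.trans h2).norm_left

lemma div_isBigO (c : ℝ) :
    (fun n : ℕ => ((c / n : ℝ) : ℂ)) =O[atTop] fun n : ℕ => (n : ℝ) ^ (-1 : ℝ) := by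
  refine IsBigO.of_bound |c| (Eventually.of_forall fun n => le_of_eq ?_)
  rw [Complex.norm_real, Real.rpow_neg_one, norm_div, norm_inv, div_eq_mul_inv, Real.norm_eq_abs]

lemma one_add_div_rpow_sub_one_isBigO (c γ : ℝ) :
    (fun n : ℕ => (((1 + c / n) ^ γ - 1 : ℝ) : ℂ)) =O[atTop] fun n : ℕ => (n : ℝ) ^ (-1 : ℝ) := by
  refine ((isBigO_real_rpow_of_le (one_add_div_rpow_sub_isBigO c γ) (by norm_num)).add
    ((div_isBigO c).const_mul_left γ)).congr_left fun n => ?_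
  push_cast
  ring

lemma one_add_div_rpow_isBigO_one (c γ : ℝ) :
    (fun n : ℕ => (((1 + c / n) ^ γ : ℝ) : ℂ)) =O[atTop] fun _ : ℕ => (1 : ℝ) := by
  have h1 : (fun n : ℕ => (((1 + c / n) ^ γ - 1 : ℝ) : ℂ)) =O[atTop] fun _ : ℕ => (1 : ℝ) := by
    simpa using isBigO_real_rpow_of_le (one_add_div_rpow_sub_one_isBigO c γ)
      (by norm_num : (-1 : ℝ) ≤ 0)
  refine (h1.add (isBigO_refl (fun _ : ℕ => (1 : ℂ)) atTop |>.trans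
    (IsBigO.of_bound 1 (by simp)))).congr_left fun n => ?_
  push_cast
  ring

lemma succ_rpow_eq (γ : ℝ) {n : ℕ} (hn : 1 ≤ n) :
    ((n + 1 : ℕ) : ℝ) ^ γ = (n : ℝ) ^ γ * (1 + 1 / n) ^ γ := by
  have h0 : (0 : ℝ) < n := by exact_mod_cast hn
  rw [← Real.mul_rpow h0.le (by positivity)]
  congr 1
  push_cast
  field_simp

lemma two_mul_add_one_rpow_eq (γ : ℝ) {n : ℕ} (hn : 1 ≤ n) :
    ((2 * n + 1 : ℕ) : ℝ) ^ γ = 2 ^ γ * (n : ℝ) ^ γ * (1 + (1 / 2) / n) ^ γ := by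
  have h0 : (0 : ℝ) < n := by exact_mod_cast hn
  rw [← Real.mul_rpow zero_le_two h0.le, ← Real.mul_rpow (by positivity) (by positivity)]
  congr 1
  push_cast
  field_simp

lemma succ_rpow_sub_isBigO (γ : ℝ) :
    (fun n : ℕ => ((((n + 1 : ℕ) : ℝ) ^ γ - (n : ℝ) ^ γ : ℝ) : ℂ)) =O[atTop]
      fun n : ℕ => (n : ℝ) ^ (γ - 1) := by
  refine (isBigO_real_rpow_mul (natCast_rpow_isBigO le_rfl)
    (one_add_div_rpow_sub_one_isBigO 1 γ) (by linarith : γ + -1 ≤ γ - 1)).congr' ?_ EventuallyEq.rfl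
  filter_upwards [eventually_ge_atTop 1] with n hn
  rw [succ_rpow_eq γ hn]
  push_cast
  ring

lemma succ_rpow_sub_sub_isBigO (γ : ℝ) :
    (fun n : ℕ => ((((n + 1 : ℕ) : ℝ) ^ γ - (n : ℝ) ^ γ - γ * (n : ℝ) ^ (γ - 1) : ℝ) : ℂ))
      =O[atTop] fun n : ℕ => (n : ℝ) ^ (γ - 2) := by
  refine (isBigO_real_rpow_mul (natCast_rpow_isBigO le_rfl)
    (one_add_div_rpow_sub_isBigO 1 γ) (by linarith : γ + -2 ≤ γ - 2)).congr' ?_ EventuallyEq.rfl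
  filter_upwards [eventually_ge_atTop 1] with n hn
  have h0 : (0 : ℝ) < n := by exact_mod_cast hn
  rw [succ_rpow_eq γ hn, Real.rpow_sub_one h0.ne']
  push_cast
  ring

lemma rpow_mul_rpow_sub_isBigO (a c : ℝ) :
    (fun n : ℕ => (((1 + (1 / 2) / n) ^ a * (1 + 1 / n) ^ c - (1 + (a / 2 + c) / n) : ℝ) : ℂ))
      =O[atTop] fun n : ℕ => (n : ℝ) ^ (-2 : ℝ) := by
  have h1 := one_add_div_rpow_sub_isBigO (1 / 2) a
  have h2 := one_add_div_rpow_sub_isBigO 1 c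
  have h3 := isBigO_real_rpow_mul (one_add_div_rpow_sub_one_isBigO (1 / 2) a)
    (one_add_div_rpow_sub_one_isBigO 1 c) (by norm_num : (-1 : ℝ) + -1 ≤ -2)
  refine ((h1.add h2).add h3).congr_left fun n => ?_
  push_cast
  ring

/-! ### The transfer matrix in the approximately diagonalising coordinates -/

/-- A recurrence `X' = A X + B Y`, `Y' = C Y + D X'` whose coefficients are, modulo errors of order
`g`, `A = 1 - δ`, `C = 1 + δ` and `B = D = ε`. In the coordinates `X` and `Z = Y - s X`, with
`s = ε / 2 + δ / ε`, its matrix is, modulo `g`, symmetric with constant diagonal, so that `X ± Z`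
decouple with multipliers `1 ± ε + ε ^ 2 / 2 = exp (± z)`. -/
structure ApproxDiagonalizable (A B C D s s' ε δ z : ℕ → ℂ) (g : ℕ → ℝ) : Prop where
  hA : (fun n => A n - (1 - δ n)) =O[atTop] g
  hB : (fun n => B n - ε n) =O[atTop] g
  hC : (fun n => C n - (1 + δ n)) =O[atTop] g
  hD : (fun n => D n - ε n) =O[atTop] g
  hs : (fun n => s' n - s n) =O[atTop] g
  hεs : ∀ᶠ n in atTop, ε n * s n = ε n ^ 2 / 2 + δ n
  hε : ε =O[atTop] fun _ => (1 : ℝ)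
  hδ : δ =O[atTop] fun _ => (1 : ℝ)
  hs1 : s =O[atTop] fun _ => (1 : ℝ)
  hε3 : (fun n => ε n ^ 3) =O[atTop] g
  hεδ : (fun n => ε n * δ n) =O[atTop] g
  hδs : (fun n => δ n * s n) =O[atTop] g
  hz : (fun n => Complex.exp (z n) - (1 + ε n + ε n ^ 2 / 2)) =O[atTop] g
  hz' : (fun n => Complex.exp (-z n) - (1 - ε n + ε n ^ 2 / 2)) =O[atTop] g
  hg : g =O[atTop] fun _ => (1 : ℝ)

namespace ApproxDiagonalizable

variable {A B C D s s' ε δ z : ℕ → ℂ} {g : ℕ → ℝ}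

lemma m11 (h : ApproxDiagonalizable A B C D s s' ε δ z g) :
    (fun n => A n + B n * s n - (1 + ε n ^ 2 / 2)) =O[atTop] g := by
  refine (h.hA.add (isBigO_one_mul h.hs1 h.hB)).congr' ?_ EventuallyEq.rfl
  filter_upwards [h.hεs] with n hn
  linear_combination -hn

lemma m21 (h : ApproxDiagonalizable A B C D s s' ε δ z g) :
    (fun n => C n * s n + (D n - s' n) * (A n + B n * s n) - ε n) =O[atTop] g := by
  have h1 := isBigO_one_mul h.hs1 h.hC
  have hDs : (fun n => D n - s' n - (ε n - s n)) =O[atTop] g :=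
    (h.hD.sub h.hs).congr_left fun n => by ring
  have hm : (fun n => A n + B n * s n) =O[atTop] fun _ => (1 : ℝ) := by
    refine ((h.m11.trans h.hg).add (((isBigO_refl (fun _ : ℕ => (1 : ℂ)) atTop).trans
      (IsBigO.of_bound 1 (by simp))).add
      ((isBigO_one_mul h.hε h.hε).const_mul_left (1 / 2)))).congr_left fun n => ?_
    ring
  have hεs : (fun n => ε n - s n) =O[atTop] fun _ => (1 : ℝ) := h.hε.sub h.hs1
  have h2 := isBigO_one_mul hm hDs
  have h3 := isBigO_one_mul hεs h.m11
  -- The products `δ * s`, `ε ^ 3` and `ε * δ` are the only other terms left over.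
  refine ((((((h1.add h2).add h3).add h.hδs).add (h.hε3.const_mul_left (1 / 4))).add
    (h.hεδ.const_mul_left (-(1 / 2))))).congr' ?_ EventuallyEq.rfl
  filter_upwards [h.hεs] with n hn
  linear_combination (1 / 2) * ε n * hn

lemma m22 (h : ApproxDiagonalizable A B C D s s' ε δ z g) :
    (fun n => C n + (D n - s' n) * B n - (1 + ε n ^ 2 / 2)) =O[atTop] g := by
  have hDs : (fun n => D n - s' n - (ε n - s n)) =O[atTop] g :=
    (h.hD.sub h.hs).congr_left fun n => by ring
  have hB1 : B =O[atTop] fun _ => (1 : ℝ) :=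
    ((h.hB.trans h.hg).add h.hε).congr_left fun n => by ring
  have hεs : (fun n => ε n - s n) =O[atTop] fun _ => (1 : ℝ) := h.hε.sub h.hs1
  refine ((h.hC.add (isBigO_one_mul hB1 hDs)).add (isBigO_one_mul hεs h.hB)).congr' ?_
    EventuallyEq.rfl
  filter_upwards [h.hεs] with n hn
  linear_combination hn

/-- If `m` is the matrix of the recurrence in the coordinates `(X, Z)`, then passing to
`(X ± Z) / 2` and dividing by `exp z` leaves the diagonal matrix with entries `1` and
`exp (-2 * z)`, up to a perturbation, with the following four entries, of order `g`. -/
lemma entries (h : ApproxDiagonalizable A B C D s s' ε δ z g) (m₁₁ m₁₂ m₂₁ m₂₂ : ℕ → ℂ)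
    (e₁₁ : ∀ n, m₁₁ n = A n + B n * s n) (e₁₂ : ∀ n, m₁₂ n = B n)
    (e₂₁ : ∀ n, m₂₁ n = C n * s n + (D n - s' n) * (A n + B n * s n))
    (e₂₂ : ∀ n, m₂₂ n = C n + (D n - s' n) * B n) :
    (fun n => Complex.exp (-z n) * ((m₁₁ n + m₁₂ n + m₂₁ n + m₂₂ n) / 2 - Complex.exp (z n)))
        =O[atTop] g ∧
    (fun n => Complex.exp (-z n) * ((m₁₁ n - m₁₂ n + m₂₁ n - m₂₂ n) / 2)) =O[atTop] g ∧
    (fun n => Complex.exp (-z n) * ((m₁₁ n + m₁₂ n - m₂₁ n - m₂₂ n) / 2)) =O[atTop] g ∧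
    (fun n => Complex.exp (-z n) * ((m₁₁ n - m₁₂ n - m₂₁ n + m₂₂ n) / 2 - Complex.exp (-z n)))
        =O[atTop] g := by
  have hm₁₁ := h.m11.const_mul_left (1 / 2)
  have hm₁₂ := h.hB.const_mul_left (1 / 2)
  have hm₂₁ := h.m21.const_mul_left (1 / 2)
  have hm₂₂ := h.m22.const_mul_left (1 / 2)
  have hexp : (fun n => Complex.exp (-z n)) =O[atTop] fun _ => (1 : ℝ) := by
    refine ((h.hz'.trans h.hg).add ((((isBigO_refl (fun _ : ℕ => (1 : ℂ)) atTop).trans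
      (IsBigO.of_bound 1 (by simp))).sub h.hε).add
      ((isBigO_one_mul h.hε h.hε).const_mul_left (1 / 2)))).congr_left fun n => ?_
    ring
  refine ⟨isBigO_one_mul hexp ?_, isBigO_one_mul hexp ?_, isBigO_one_mul hexp ?_,
    isBigO_one_mul hexp ?_⟩
  · refine ((((hm₁₁.add hm₁₂).add hm₂₁).add hm₂₂).sub h.hz).congr_left fun n => ?_
    rw [e₁₁, e₁₂, e₂₁, e₂₂]; ring
  · refine (((hm₁₁.sub hm₁₂).add hm₂₁).sub hm₂₂).congr_left fun n => ?_
    rw [e₁₁, e₁₂, e₂₁, e₂₂]; ring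
  · refine (((hm₁₁.add hm₁₂).sub hm₂₁).sub hm₂₂).congr_left fun n => ?_
    rw [e₁₁, e₁₂, e₂₁, e₂₂]; ring
  · refine ((((hm₁₁.sub hm₁₂).sub hm₂₁).add hm₂₂).sub h.hz').congr_left fun n => ?_
    rw [e₁₁, e₁₂, e₂₁, e₂₂]; ring

end ApproxDiagonalizable

lemma SolvesFrom.congr {E r₁₁ r₁₂ r₂₁ r₂₂ p q p' q' : ℕ → ℂ} {N : ℕ}
    (h : SolvesFrom E r₁₁ r₁₂ r₂₁ r₂₂ p q N) (h' : SolvesFrom E r₁₁ r₁₂ r₂₁ r₂₂ p' q' N)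
    (hp : p N = p' N) (hq : q N = q' N) {n : ℕ} (hn : N ≤ n) : p n = p' n ∧ q n = q' n := by
  induction n, hn using Nat.le_induction with
  | base => exact ⟨hp, hq⟩
  | succ n hn ih =>
    rw [(h n hn).1, (h n hn).2, (h' n hn).1, (h' n hn).2, ih.1, ih.2]
    exact ⟨rfl, rfl⟩

/-- Asymptotics of one solution of an approximately diagonalisable recurrence: with suitable initial
values, both `X` and `Y` are asymptotic to `exp w`, where the increment of `w` is the exponent `z`
of the multipliers. -/
lemma ApproxDiagonalizable.exists_initial {A B C D s ε δ w : ℕ → ℂ} {g : ℕ → ℝ}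
    (h : ApproxDiagonalizable A B C D s (fun n => s (n + 1)) ε δ (fun n => w (n + 1) - w n) g)
    (hg : Summable g) (hs : Tendsto s atTop (𝓝 0))
    (hE : (Monotone fun n => ‖Complex.exp (-2 * w n)‖) ∨
      ((Antitone fun n => ‖Complex.exp (-2 * w n)‖) ∧
        Tendsto (fun n => Complex.exp (-2 * w n)) atTop (𝓝 0))) :
    ∃ N, 1 ≤ N ∧ ∃ X₀ Y₀ : ℂ, ∀ X Y : ℕ → ℂ,
      (∀ n, N ≤ n → X (n + 1) = A n * X n + B n * Y n ∧
        Y (n + 1) = C n * Y n + D n * X (n + 1)) → X N = X₀ → Y N = Y₀ →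
      Tendsto (fun n => X n * Complex.exp (-w n)) atTop (𝓝 1) ∧
      Tendsto (fun n => Y n * Complex.exp (-w n)) atTop (𝓝 1) := by
  obtain ⟨h₁₁, h₁₂, h₂₁, h₂₂⟩ := h.entries (fun n => A n + B n * s n) B
    (fun n => C n * s n + (D n - s (n + 1)) * (A n + B n * s n))
    (fun n => C n + (D n - s (n + 1)) * B n)
    (fun _ => rfl) (fun _ => rfl) (fun _ => rfl) (fun _ => rfl)
  obtain ⟨N, hN, p, q, hpq, hp, hq⟩ := exists_solvesFrom_tendsto
    (fun n => Complex.exp_ne_zero (-2 * w n)) hE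
    (summable_of_isBigO_nat hg h₁₁.norm_left) (summable_of_isBigO_nat hg h₁₂.norm_left)
    (summable_of_isBigO_nat hg h₂₁.norm_left) (summable_of_isBigO_nat hg h₂₂.norm_left)
  refine ⟨N, hN, Complex.exp (w N) * (p N + q N),
    Complex.exp (w N) * (p N - q N) + s N * (Complex.exp (w N) * (p N + q N)), ?_⟩
  intro X Y hXY hX₀ hY₀
  have hww : ∀ n, Complex.exp (-w n) * Complex.exp (w n) = 1 := fun n => by
    rw [← Complex.exp_add]; simp
  let P : ℕ → ℂ := fun n => Complex.exp (-w n) * ((X n + (Y n - s n * X n)) / 2)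
  let Q : ℕ → ℂ := fun n => Complex.exp (-w n) * ((X n - (Y n - s n * X n)) / 2)
  have hPQ := fun n => show P n = Complex.exp (-w n) * ((X n + (Y n - s n * X n)) / 2) ∧
    Q n = Complex.exp (-w n) * ((X n - (Y n - s n * X n)) / 2) from ⟨rfl, rfl⟩
  have hagree : ∀ n, N ≤ n → P n = p n ∧ Q n = q n := by
    intro n hn
    refine SolvesFrom.congr (p := P) (q := Q) ?_ hpq ?_ ?_ hn
    · intro n hn
      obtain ⟨h1, h2⟩ := hXY n hn
      have e1 : Complex.exp (-w (n + 1)) =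
          Complex.exp (-(w (n + 1) - w n)) * Complex.exp (-w n) := by
        rw [← Complex.exp_add]; congr 1; ring
      have e2 : Complex.exp (-(w (n + 1) - w n)) * Complex.exp (w (n + 1) - w n) = 1 := by
        rw [← Complex.exp_add]; simp
      have e3 : Complex.exp (-2 * w (n + 1)) / Complex.exp (-2 * w n) =
          Complex.exp (-(w (n + 1) - w n)) * Complex.exp (-(w (n + 1) - w n)) := by
        rw [← Complex.exp_sub, ← Complex.exp_add]; congr 1; ring
      simp only [(hPQ _).1, (hPQ _).2, h2, h1, e3, e1]
      constructor
      · linear_combination (Complex.exp (-w n) * ((X n + (Y n - s n * X n)) / 2)) * e2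
      · ring
    · simp only [(hPQ _).1, hX₀, hY₀]; linear_combination p N * hww N
    · simp only [(hPQ _).2, hX₀, hY₀]; linear_combination q N * hww N
  have hP : Tendsto P atTop (𝓝 1) := hp.congr' <| by
    filter_upwards [eventually_ge_atTop N] with n hn using (hagree n hn).1.symm
  have hQ : Tendsto Q atTop (𝓝 0) := hq.congr' <| by
    filter_upwards [eventually_ge_atTop N] with n hn using (hagree n hn).2.symm
  have hX : Tendsto (fun n => X n * Complex.exp (-w n)) atTop (𝓝 1) := by
    have := hP.add hQ
    rw [add_zero] at this
    refine this.congr fun n => ?_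
    rw [(hPQ n).1, (hPQ n).2]; ring
  refine ⟨hX, ?_⟩
  have := (hP.sub hQ).add (hs.mul hX)
  rw [sub_zero, zero_mul, add_zero] at this
  refine this.congr fun n => ?_
  rw [(hPQ n).1, (hPQ n).2]; ring

/-! ### The spectral recurrence in WKB coordinates -/

/-- The phase `n ^ (1 - α / 2) / (1 - α / 2)`, a primitive of `n ^ (-α / 2)`. -/
noncomputable def wkbPhase (α : ℝ) (n : ℕ) : ℝ := (n : ℝ) ^ (1 - α / 2) / (1 - α / 2)

/-- Coefficients of the recurrence for `X n = (-1) ^ n * n ^ (α / 4) * U (2 * n)` and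
`Y n = (-1) ^ n * n ^ (3 * α / 4) / κ * U (2 * n + 1)`, when `U` solves the spectral recurrence. -/
lemma IsSpectralSeq.wkb_recurrence {α b lam : ℝ} {β κ : ℂ} (hκ0 : κ ≠ 0)
    (hβκ' : β * κ = ((lam / 2 ^ α : ℝ) : ℂ)) {U : ℕ → ℂ}
    (hU : IsSpectralSeq α b lam U) {X Y : ℕ → ℂ}
    (hX : ∀ n, X n = (-1) ^ n * (((n : ℝ) ^ (α / 4) : ℝ) : ℂ) * U (2 * n))
    (hY : ∀ n, Y n = (-1) ^ n * (((n : ℝ) ^ (3 * α / 4) : ℝ) : ℂ) / κ * U (2 * n + 1))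
    {n : ℕ} (hn : 1 ≤ n) :
    X (n + 1) = (((1 + (1 / 2) / n) ^ (-α) * (1 + 1 / n) ^ (α / 4) : ℝ) : ℂ) * X n +
      (((b - lam * ((2 * n + 1 : ℕ) : ℝ) ^ (-α) : ℝ) : ℂ) * κ *
        (((n : ℝ) ^ (-α / 2) * (1 + 1 / n) ^ (α / 4) : ℝ) : ℂ)) * Y n ∧
    Y (n + 1) = (((1 + (1 / 2) / n) ^ α * (1 + 1 / n) ^ (-α / 4) : ℝ) : ℂ) * Y n +
      β * ((((n + 1 : ℕ) : ℝ) ^ (-α / 2) : ℝ) : ℂ) * X (n + 1) := by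
  have hn0 : (0 : ℝ) < n := by exact_mod_cast hn
  obtain ⟨m, hm⟩ : ∃ m : ℝ, m = (n : ℝ) ^ (α / 4) := ⟨_, rfl⟩
  obtain ⟨r, hr⟩ : ∃ r : ℝ, r = (1 + 1 / (n : ℝ)) ^ (α / 4) := ⟨_, rfl⟩
  obtain ⟨t, ht⟩ : ∃ t : ℝ, t = (1 + (1 / 2) / (n : ℝ)) ^ α := ⟨_, rfl⟩
  obtain ⟨k, hk⟩ : ∃ k : ℝ, k = (2 : ℝ) ^ α := ⟨_, rfl⟩
  have hm0 : 0 < m := hm ▸ Real.rpow_pos_of_pos hn0 _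
  have hr0 : 0 < r := hr ▸ Real.rpow_pos_of_pos (by positivity) _
  have ht0 : 0 < t := ht ▸ Real.rpow_pos_of_pos (by positivity) _
  have hk0 : 0 < k := hk ▸ Real.rpow_pos_of_pos two_pos _
  -- All powers involved are monomials in `m`, `r`, `t` and `k`; the claim is then rational algebra.
  have hpow : ∀ (x : ℝ), 0 ≤ x → ∀ j : ℕ, x ^ (j * α / 4) = (x ^ (α / 4)) ^ j := fun x hx j => by
    rw [← Real.rpow_natCast, ← Real.rpow_mul hx]; congr 1; ring
  have hsucc : ((n + 1 : ℕ) : ℝ) ^ (α / 4) = m * r := by rw [succ_rpow_eq _ hn, hm, hr]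
  have hn4 : (n : ℝ) ^ α = m ^ 4 := by
    rw [hm, ← hpow _ hn0.le]; congr 1; push_cast; ring
  have hn3 : (n : ℝ) ^ (3 * α / 4) = m ^ 3 := by
    rw [hm, ← hpow _ hn0.le]; norm_cast
  have hn2 : (n : ℝ) ^ (-α / 2) = (m ^ 2)⁻¹ := by
    rw [hm, ← hpow _ hn0.le, ← Real.rpow_neg hn0.le]; congr 1; push_cast; ring
  have hs4 : ((n + 1 : ℕ) : ℝ) ^ α = (m * r) ^ 4 := by
    rw [← hsucc, ← hpow _ (Nat.cast_nonneg _)]; congr 1; push_cast; ring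
  have hs3 : ((n + 1 : ℕ) : ℝ) ^ (3 * α / 4) = (m * r) ^ 3 := by
    rw [← hsucc, ← hpow _ (Nat.cast_nonneg _)]; norm_cast
  have hs2 : ((n + 1 : ℕ) : ℝ) ^ (-α / 2) = ((m * r) ^ 2)⁻¹ := by
    rw [← hsucc, ← hpow _ (Nat.cast_nonneg _), ← Real.rpow_neg (Nat.cast_nonneg _)]
    congr 1; push_cast; ring
  have he : ((2 * n : ℕ) : ℝ) ^ α = k * m ^ 4 := by
    push_cast; rw [Real.mul_rpow zero_le_two hn0.le, hn4, hk]
  have ho : ((2 * n + 1 : ℕ) : ℝ) ^ α = k * m ^ 4 * t := by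
    rw [two_mul_add_one_rpow_eq _ hn, hn4, hk, ht]
  have ho' : ((2 * n + 1 : ℕ) : ℝ) ^ (-α) = (k * m ^ 4 * t)⁻¹ := by
    rw [Real.rpow_neg (Nat.cast_nonneg _), ho]
  have he' : ((2 * n + 1 + 1 : ℕ) : ℝ) ^ α = k * (m * r) ^ 4 := by
    rw [show 2 * n + 1 + 1 = 2 * (n + 1) by ring, Nat.cast_mul, Nat.cast_two,
      Real.mul_rpow zero_le_two (Nat.cast_nonneg _), hs4, hk]
  have ht' : (1 + (1 / 2) / (n : ℝ)) ^ (-α) = t⁻¹ := by rw [Real.rpow_neg (by positivity), ht]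
  have hr' : (1 + 1 / (n : ℝ)) ^ (-α / 4) = r⁻¹ := by
    rw [neg_div, Real.rpow_neg (by positivity), hr]
  have h1 := hU (2 * n) (by omega)
  have h2 := hU (2 * n + 1) (by omega)
  rw [if_pos (by simp), he, ho] at h1
  rw [if_neg (by simp [Nat.odd_add_one]), ho, he'] at h2
  simp only [hX, hY, show 2 * (n + 1) = 2 * n + 2 by ring]
  rw [hsucc, hs3, hs2, hn3, hn2, ho', ht', hr', ← hm, ← hr, ← ht]
  rw [← hk] at hβκ'
  have hmc : (m : ℂ) ≠ 0 := by exact_mod_cast hm0.ne'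
  have hrc : (r : ℂ) ≠ 0 := by exact_mod_cast hr0.ne'
  have htc : (t : ℂ) ≠ 0 := by exact_mod_cast ht0.ne'
  have hkc : (k : ℂ) ≠ 0 := by exact_mod_cast hk0.ne'
  have hβ' : β = (lam : ℂ) / k / κ := by
    rw [eq_div_iff hκ0, hβκ']; push_cast; ring
  push_cast at h1 h2 ⊢
  constructor
  · field_simp
    rw [pow_succ]
    linear_combination (-(-1) ^ n) * h1
  · rw [hβ']
    field_simp
    rw [pow_succ]
    linear_combination (-(-1) ^ n) * h2

/-! ### A solution with WKB asymptotics -/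

/-- The multiplier `1 + ε + ε ^ 2 / 2` agrees with `exp z` up to the cube of `ε`. -/
lemma exp_sub_isBigO {α : ℝ} (hα : 0 < α) {z ε : ℕ → ℂ}
    (hz : (fun n => z n - ε n) =O[atTop] fun n : ℕ => (n : ℝ) ^ (-(3 * α / 2)))
    (hε : ε =O[atTop] fun n : ℕ => (n : ℝ) ^ (-α / 2)) :
    (fun n => Complex.exp (z n) - (1 + ε n + ε n ^ 2 / 2)) =O[atTop]
      fun n : ℕ => (n : ℝ) ^ (-(3 * α / 2)) := by
  have hzO : z =O[atTop] fun n : ℕ => (n : ℝ) ^ (-α / 2) :=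
    ((isBigO_real_rpow_of_le hz (by linarith)).add hε).congr_left fun n => by ring
  have hz2 := isBigO_real_rpow_mul hzO hzO (by linarith : -α / 2 + -α / 2 ≤ -α)
  have hz3 := isBigO_real_rpow_mul hz2 hzO (by linarith : -α + -α / 2 ≤ -(3 * α / 2))
  have hz0 : Tendsto z atTop (𝓝 0) := hzO.trans_tendsto <| by
    rw [neg_div]
    exact (tendsto_rpow_neg_atTop (half_pos hα)).comp tendsto_natCast_atTop_atTop
  have h1 : (fun n => Complex.exp (z n) - (1 + z n + z n ^ 2 / 2)) =O[atTop]
      fun n : ℕ => (n : ℝ) ^ (-(3 * α / 2)) := by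
    refine (((Complex.exp_sub_sum_range_isBigO_pow 3).comp_tendsto hz0).trans
      (hz3.congr_left fun n => ?_)).congr_left fun n => ?_
    · simp only [Function.comp]; ring
    · simp [Finset.sum_range_succ, Nat.factorial]
  have h2 := isBigO_real_rpow_mul hz (hzO.add hε)
    (by linarith : -(3 * α / 2) + -α / 2 ≤ -(3 * α / 2))
  refine ((h1.add hz).add (h2.const_mul_left (1 / 2))).congr_left fun n => ?_
  ring

lemma wkbPhase_monotone {α : ℝ} (hα' : α < 1) : Monotone (wkbPhase α) := fun m n hmn => by
  have h : (0 : ℝ) ≤ 1 - α / 2 := by linarith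
  unfold wkbPhase
  gcongr

lemma tendsto_wkbPhase {α : ℝ} (hα' : α < 1) : Tendsto (wkbPhase α) atTop atTop :=
  ((tendsto_rpow_atTop (by linarith)).comp tendsto_natCast_atTop_atTop).atTop_div_const
    (by linarith)

/-- The two cases are `re β ≤ 0` and `re β > 0`. -/
lemma norm_exp_wkbPhase_dichotomy {α : ℝ} (hα' : α < 1) (β : ℂ) :
    (Monotone fun n => ‖Complex.exp (-2 * (β * (wkbPhase α n : ℂ)))‖) ∨
      ((Antitone fun n => ‖Complex.exp (-2 * (β * (wkbPhase α n : ℂ)))‖) ∧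
        Tendsto (fun n => Complex.exp (-2 * (β * (wkbPhase α n : ℂ)))) atTop (𝓝 0)) := by
  have hnorm : ∀ n, ‖Complex.exp (-2 * (β * (wkbPhase α n : ℂ)))‖ =
      Real.exp (-(2 * β.re) * wkbPhase α n) := fun n => by
    rw [Complex.norm_exp]
    congr 1
    simp
    ring
  rcases le_or_gt β.re 0 with h | h
  · left
    intro m n hmn
    simp only [hnorm]
    exact Real.exp_le_exp.2 (mul_le_mul_of_nonneg_left (wkbPhase_monotone hα' hmn) (by linarith))
  · right
    refine ⟨fun m n hmn => ?_, ?_⟩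
    · simp only [hnorm]
      exact Real.exp_le_exp.2
        (mul_le_mul_of_nonpos_left (wkbPhase_monotone hα' hmn) (by linarith))
    · rw [tendsto_zero_iff_norm_tendsto_zero]
      simp only [hnorm]
      exact Real.tendsto_exp_atBot.comp
        ((tendsto_wkbPhase hα').const_mul_atTop_of_neg (by linarith))

/-- The first-order correction to the diagonalising coordinates. With `ε = β * n ^ (-α / 2)` and
`δ = α / (4 * n)` it equals `ε / 2 + δ / ε`. -/
noncomputable def wkbShift (α : ℝ) (β : ℂ) (n : ℕ) : ℂ :=
  β / 2 * (((n : ℝ) ^ (-α / 2) : ℝ) : ℂ) + α / (4 * β) * (((n : ℝ) ^ (α / 2 - 1) : ℝ) : ℂ)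

lemma wkbShift_isBigO {α : ℝ} (hα' : α < 1) (β : ℂ) :
    wkbShift α β =O[atTop] fun n : ℕ => (n : ℝ) ^ (-α / 2) :=
  ((natCast_rpow_isBigO le_rfl).const_mul_left _).add
    ((natCast_rpow_isBigO (by linarith)).const_mul_left _)

lemma tendsto_wkbShift {α : ℝ} (hα : 0 < α) (hα' : α < 1) (β : ℂ) :
    Tendsto (wkbShift α β) atTop (𝓝 0) := (wkbShift_isBigO hα' β).trans_tendsto <| by
  rw [neg_div]
  exact (tendsto_rpow_neg_atTop (half_pos hα)).comp tendsto_natCast_atTop_atTop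

/-- The recurrence in WKB coordinates is approximately diagonalisable with errors of order
`n ^ (-3 * α / 2)`. -/
lemma approxDiagonalizable_wkb {α b lam : ℝ} {β κ : ℂ} (hα : 0 < α) (hα' : α < 1)
    (hβ0 : β ≠ 0) (hβκ : β = (b : ℂ) * κ) :
    ApproxDiagonalizable
      (fun n : ℕ => (((1 + (1 / 2) / n) ^ (-α) * (1 + 1 / n) ^ (α / 4) : ℝ) : ℂ))
      (fun n : ℕ => ((b - lam * ((2 * n + 1 : ℕ) : ℝ) ^ (-α) : ℝ) : ℂ) * κ *
        (((n : ℝ) ^ (-α / 2) * (1 + 1 / n) ^ (α / 4) : ℝ) : ℂ))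
      (fun n : ℕ => (((1 + (1 / 2) / n) ^ α * (1 + 1 / n) ^ (-α / 4) : ℝ) : ℂ))
      (fun n : ℕ => β * ((((n + 1 : ℕ) : ℝ) ^ (-α / 2) : ℝ) : ℂ))
      (wkbShift α β) (fun n => wkbShift α β (n + 1))
      (fun n : ℕ => β * (((n : ℝ) ^ (-α / 2) : ℝ) : ℂ))
      (fun n : ℕ => (((α / 4) / n : ℝ) : ℂ))
      (fun n => β * (wkbPhase α (n + 1) : ℂ) - β * (wkbPhase α n : ℂ))
      (fun n : ℕ => (n : ℝ) ^ (-(3 * α / 2))) := by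
  have hεO : (fun n : ℕ => β * (((n : ℝ) ^ (-α / 2) : ℝ) : ℂ)) =O[atTop]
      fun n : ℕ => (n : ℝ) ^ (-α / 2) := (natCast_rpow_isBigO le_rfl).const_mul_left β
  have hδO := div_isBigO (α / 4)
  have hsO := wkbShift_isBigO hα' β
  have hone : ∀ {f : ℕ → ℂ} {a : ℝ}, f =O[atTop] (fun n : ℕ => (n : ℝ) ^ a) → a ≤ 0 →
      f =O[atTop] fun _ : ℕ => (1 : ℝ) := fun hf ha => by
    simpa using isBigO_real_rpow_of_le hf ha
  have hzε : (fun n : ℕ => β * (wkbPhase α (n + 1) : ℂ) - β * (wkbPhase α n : ℂ) -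
      β * (((n : ℝ) ^ (-α / 2) : ℝ) : ℂ)) =O[atTop] fun n : ℕ => (n : ℝ) ^ (-(3 * α / 2)) := by
    have h0 : (1 - α / 2 : ℝ) ≠ 0 := by linarith
    have h := isBigO_real_rpow_of_le (b := -(3 * α / 2))
      (succ_rpow_sub_sub_isBigO (1 - α / 2)) (by linarith)
    refine (h.const_mul_left (β / ((1 - α / 2 : ℝ) : ℂ))).congr_left fun n => ?_
    have h0c : ((1 - α / 2 : ℝ) : ℂ) ≠ 0 := by exact_mod_cast h0
    rw [show 1 - α / 2 - 1 = -α / 2 by ring]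
    unfold wkbPhase
    generalize 1 - α / 2 = γ at h0c
    push_cast
    field_simp
  refine ⟨?_, ?_, ?_, ?_, ?_, ?_, hone hεO (by linarith), hone hδO (by norm_num),
    hone hsO (by linarith), ?_, ?_, ?_, exp_sub_isBigO hα hzε hεO, ?_, ?_⟩
  · refine (isBigO_real_rpow_of_le (rpow_mul_rpow_sub_isBigO (-α) (α / 4))
      (by linarith)).congr_left fun n => ?_
    push_cast; ring
  · have h1 := isBigO_real_rpow_mul (c := -(3 * α / 2)) hεO
      (one_add_div_rpow_sub_one_isBigO 1 (α / 4)) (by linarith)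
    have h2 := isBigO_real_rpow_mul (c := -(3 * α / 2)) (natCast_rpow_isBigO (le_refl (-α)))
      (natCast_rpow_isBigO (le_refl (-α / 2))) (by linarith)
    have h3 := isBigO_one_mul (one_add_div_rpow_isBigO_one (1 / 2) (-α)) h2
    have h4 := isBigO_one_mul (one_add_div_rpow_isBigO_one 1 (α / 4)) h3
    refine (h1.sub (h4.const_mul_left (lam * κ * ((2 ^ (-α) : ℝ) : ℂ)))).congr' ?_
      EventuallyEq.rfl
    filter_upwards [eventually_ge_atTop 1] with n hn
    rw [two_mul_add_one_rpow_eq _ hn, hβκ]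
    push_cast; ring
  · refine (isBigO_real_rpow_of_le (rpow_mul_rpow_sub_isBigO α (-α / 4))
      (by linarith)).congr_left fun n => ?_
    push_cast; ring
  · refine ((isBigO_real_rpow_of_le (succ_rpow_sub_isBigO (-α / 2))
      (by linarith)).const_mul_left β).congr_left fun n => ?_
    push_cast; ring
  · have h1 := isBigO_real_rpow_of_le (b := -(3 * α / 2)) (succ_rpow_sub_isBigO (-α / 2))
      (by linarith)
    have h2 := isBigO_real_rpow_of_le (b := -(3 * α / 2)) (succ_rpow_sub_isBigO (α / 2 - 1))
      (by linarith)
    refine ((h1.const_mul_left (β / 2)).add (h2.const_mul_left (α / (4 * β)))).congr_left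
      fun n => ?_
    simp only [wkbShift, Complex.ofReal_sub]; ring
  · filter_upwards [eventually_ge_atTop 1] with n hn
    have hn0 : (0 : ℝ) < n := by exact_mod_cast hn
    have h : (n : ℝ) ^ (-α / 2) * (n : ℝ) ^ (α / 2 - 1) = (n : ℝ)⁻¹ := by
      rw [← Real.rpow_add hn0, ← Real.rpow_neg_one]; congr 1; ring
    have hc : ((((n : ℝ) ^ (-α / 2) : ℝ) : ℂ)) * (((n : ℝ) ^ (α / 2 - 1) : ℝ) : ℂ) =
        ((n : ℝ) : ℂ)⁻¹ := by rw [← Complex.ofReal_mul, h, Complex.ofReal_inv]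
    have hβ : β * (α / (4 * β)) = α / 4 := by field_simp
    simp only [wkbShift, Complex.ofReal_div, Complex.ofReal_ofNat, div_eq_mul_inv ((α : ℂ) / 4)]
    linear_combination (β * (α / (4 * β))) * hc + ((n : ℝ) : ℂ)⁻¹ * hβ
  · have h2 := isBigO_real_rpow_mul hεO hεO (by linarith : -α / 2 + -α / 2 ≤ -α)
    refine (isBigO_real_rpow_mul h2 hεO (by linarith)).congr_left fun n => ?_
    ring
  · exact isBigO_real_rpow_mul hεO hδO (by linarith)
  · refine ((isBigO_real_rpow_mul (c := -(3 * α / 2)) hδO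
      (natCast_rpow_isBigO (le_refl (-α / 2))) (by linarith)).const_mul_left (β / 2)).add
      ((isBigO_real_rpow_mul (c := -(3 * α / 2)) hδO
      (natCast_rpow_isBigO (le_refl (α / 2 - 1))) (by linarith)).const_mul_left
      (α / (4 * β))) |>.congr_left fun n => ?_
    simp only [wkbShift]; ring
  · refine (exp_sub_isBigO hα
      (z := fun n => -(β * (wkbPhase α (n + 1) : ℂ) - β * (wkbPhase α n : ℂ)))
      (hzε.neg_left.congr_left fun n => ?_) hεO.neg_left).congr_left fun n => ?_ <;> ring
  · have := (natCast_rpow_isBigO (show -(3 * α / 2) ≤ 0 by linarith)).norm_left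
    simp only [Complex.norm_real, Real.rpow_zero] at this
    exact this.of_norm_left

/-- One solution with the WKB asymptotics. The hypotheses are invariant under
`(β, κ) ↦ (-β, -κ)`, so this yields both members of the basis. -/
lemma exists_wkb_solution {α b lam : ℝ} {β κ : ℂ} (hα : 2 / 3 < α) (hα' : α < 1)
    (hβ0 : β ≠ 0) (hκ0 : κ ≠ 0) (hβκ : β = (b : ℂ) * κ)
    (hβκ' : β * κ = ((lam / 2 ^ α : ℝ) : ℂ)) :
    ∃ u : spectralSolutions α b lam,
      (fun n : ℕ+ => (u : ℕ+ → ℂ) (2 * n)) ~[atTop]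
        (fun n : ℕ+ => (-1 : ℂ) ^ (n : ℕ) * ((((n : ℕ) : ℝ) ^ (-α / 4) : ℝ) : ℂ) *
          Complex.exp (β * ((((n : ℕ) : ℝ) ^ (1 - α / 2) / (1 - α / 2) : ℝ) : ℂ))) ∧
      (fun n : ℕ+ => (u : ℕ+ → ℂ) (2 * n + 1)) ~[atTop]
        (fun n : ℕ+ => κ * (-1 : ℂ) ^ (n : ℕ) * ((((n : ℕ) : ℝ) ^ (-3 * α / 4) : ℝ) : ℂ) *
          Complex.exp (β * ((((n : ℕ) : ℝ) ^ (1 - α / 2) / (1 - α / 2) : ℝ) : ℂ))) := by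
  have hα0 : 0 < α := by linarith
  obtain ⟨N, hN, X₀, Y₀, hXY⟩ :=
    (approxDiagonalizable_wkb (lam := lam) hα0 hα' hβ0 hβκ).exists_initial
      (w := fun n => β * (wkbPhase α n : ℂ))
      -- Summability of `n ^ (-3 * α / 2)` is the condition `α > 2 / 3`.
      (Real.summable_nat_rpow.2 (by linarith)) (tendsto_wkbShift hα0 hα' β)
      (norm_exp_wkbPhase_dichotomy hα' β)
  have hsign : ∀ n : ℕ, (-1 : ℂ) ^ n * (-1 : ℂ) ^ n = 1 := fun n => by
    rw [← mul_pow]; simp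
  have hpow : ∀ (a : ℝ) {n : ℕ}, 1 ≤ n →
      (((n : ℝ) ^ a : ℝ) : ℂ) * (((n : ℝ) ^ (-a) : ℝ) : ℂ) = 1 := fun a n hn => by
    have hn0 : (0 : ℝ) < n := by exact_mod_cast hn
    rw [← Complex.ofReal_mul, ← Real.rpow_add hn0]
    simp
  obtain ⟨U, hU, hUe, hUo⟩ := exists_isSpectralSeq α b lam (show 1 ≤ 2 * N by omega)
    ((-1) ^ N * (((N : ℝ) ^ (-(α / 4)) : ℝ) : ℂ) * X₀)
    (κ * (-1) ^ N * (((N : ℝ) ^ (-(3 * α / 4)) : ℝ) : ℂ) * Y₀)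
  obtain ⟨hX, hY⟩ := hXY
    (fun n => (-1) ^ n * (((n : ℝ) ^ (α / 4) : ℝ) : ℂ) * U (2 * n))
    (fun n => (-1) ^ n * (((n : ℝ) ^ (3 * α / 4) : ℝ) : ℂ) / κ * U (2 * n + 1))
    (fun n hn => hU.wkb_recurrence hκ0 hβκ' (fun _ => rfl) (fun _ => rfl) (hN.trans hn))
    (by
      simp only [hUe]
      linear_combination ((((N : ℝ) ^ (α / 4) : ℝ) : ℂ) * (((N : ℝ) ^ (-(α / 4)) : ℝ) : ℂ) * X₀) *
        hsign N + X₀ * hpow (α / 4) hN)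
    (by
      simp only [hUo, div_eq_mul_inv _ κ]
      linear_combination (κ⁻¹ * κ * (((N : ℝ) ^ (3 * α / 4) : ℝ) : ℂ) *
        (((N : ℝ) ^ (-(3 * α / 4)) : ℝ) : ℂ) * Y₀) * hsign N +
        κ⁻¹ * κ * Y₀ * hpow (3 * α / 4) hN + Y₀ * inv_mul_cancel₀ hκ0)
  have hmem : (fun k : ℕ+ => U k) ∈ spectralSolutions α b lam := by
    rw [mem_spectralSolutions_iff]
    intro k hk
    have := hU k hk
    simpa [Nat.toPNat'_coe, show 0 < k from hk] using this
  have hexp : ∀ x : ℂ, Complex.exp (-x) * Complex.exp x = 1 := fun x => by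
    rw [← Complex.exp_add]; simp
  have hne : ∀ (a : ℝ) (n : ℕ+), ((((n : ℕ) : ℝ) ^ a : ℝ) : ℂ) ≠ 0 := fun a n =>
    natCast_rpow_ne_zero a n.pos
  refine ⟨⟨_, hmem⟩, isEquivalent_of_tendsto_one ?_, isEquivalent_of_tendsto_one ?_⟩
  · refine (hX.comp tendsto_PNat_val_atTop_atTop).congr fun n => ?_
    have h := hpow (α / 4) n.pos
    rw [Pi.div_apply, eq_div_iff (by simp [hne, Complex.exp_ne_zero]), neg_div]
    simp only [Function.comp, PNat.mul_coe, PNat.val_ofNat]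
    change _ * _ * _ * Complex.exp (-(β * (wkbPhase α n : ℂ))) *
      (_ * _ * Complex.exp (β * (wkbPhase α n : ℂ))) = _
    linear_combination (U (2 * n) * (-1) ^ (n : ℕ) * (-1) ^ (n : ℕ)) * h +
      U (2 * n) * hsign n +
      (U (2 * n) * (-1) ^ (n : ℕ) * (-1) ^ (n : ℕ) * ((((n : ℕ) : ℝ) ^ (α / 4) : ℝ) : ℂ) *
        ((((n : ℕ) : ℝ) ^ (-(α / 4)) : ℝ) : ℂ)) * hexp (β * (wkbPhase α n : ℂ))
  · refine (hY.comp tendsto_PNat_val_atTop_atTop).congr fun n => ?_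
    have h := hpow (3 * α / 4) n.pos
    rw [Pi.div_apply, eq_div_iff (by simp [hne, hκ0, Complex.exp_ne_zero]),
      show -3 * α / 4 = -(3 * α / 4) by ring]
    simp only [Function.comp, PNat.add_coe, PNat.mul_coe, PNat.val_ofNat, div_eq_mul_inv _ κ]
    change _ * _ * _ * _ * Complex.exp (-(β * (wkbPhase α n : ℂ))) *
      (_ * _ * _ * Complex.exp (β * (wkbPhase α n : ℂ))) = U (2 * n + 1)
    linear_combination (U (2 * n + 1) * (-1) ^ (n : ℕ) * (-1) ^ (n : ℕ)) * h +
      U (2 * n + 1) * hsign n +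
      (U (2 * n + 1) * (-1) ^ (n : ℕ) * (-1) ^ (n : ℕ) *
        ((((n : ℕ) : ℝ) ^ (3 * α / 4) : ℝ) : ℂ) *
        ((((n : ℕ) : ℝ) ^ (-(3 * α / 4)) : ℝ) : ℂ)) * hexp (β * (wkbPhase α n : ℂ)) +
      (U (2 * n + 1) * (-1) ^ (n : ℕ) * (-1) ^ (n : ℕ) *
        ((((n : ℕ) : ℝ) ^ (3 * α / 4) : ℝ) : ℂ) *
        ((((n : ℕ) : ℝ) ^ (-(3 * α / 4)) : ℝ) : ℂ)) * Complex.exp (-(β * (wkbPhase α n : ℂ))) *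
        Complex.exp (β * (wkbPhase α n : ℂ)) * inv_mul_cancel₀ hκ0

/-! ### The basis of solutions -/

theorem mainTheorem1 (α b lam : ℝ) (hα : 2 / 3 < α) (hα' : α < 1) (hb : b ≠ 0) (hlam : 0 < lam)
    (β κ : ℂ) (hβ : β ^ 2 = ((b * lam / 2 ^ α : ℝ) : ℂ))
    (hκ : κ ^ 2 = ((lam / (2 ^ α * b) : ℝ) : ℂ)) (hβκ : β = (b : ℂ) * κ) :
    ∃ uPlus uMinus : spectralSolutions α b lam,
      LinearIndependent ℂ ![uPlus, uMinus] ∧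
      Submodule.span ℂ {uPlus, uMinus} = ⊤ ∧
      (fun n : ℕ+ => (uPlus : ℕ+ → ℂ) (2 * n)) ~[atTop]
        (fun n : ℕ+ => (-1 : ℂ) ^ (n : ℕ) * ((((n : ℕ) : ℝ) ^ (-α / 4) : ℝ) : ℂ) *
          Complex.exp (β * ((((n : ℕ) : ℝ) ^ (1 - α / 2) / (1 - α / 2) : ℝ) : ℂ))) ∧
      (fun n : ℕ+ => (uMinus : ℕ+ → ℂ) (2 * n)) ~[atTop]
        (fun n : ℕ+ => (-1 : ℂ) ^ (n : ℕ) * ((((n : ℕ) : ℝ) ^ (-α / 4) : ℝ) : ℂ) *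
          Complex.exp (-β * ((((n : ℕ) : ℝ) ^ (1 - α / 2) / (1 - α / 2) : ℝ) : ℂ))) ∧
      (fun n : ℕ+ => (uPlus : ℕ+ → ℂ) (2 * n + 1)) ~[atTop]
        (fun n : ℕ+ => κ * (-1 : ℂ) ^ (n : ℕ) * ((((n : ℕ) : ℝ) ^ (-3 * α / 4) : ℝ) : ℂ) *
          Complex.exp (β * ((((n : ℕ) : ℝ) ^ (1 - α / 2) / (1 - α / 2) : ℝ) : ℂ))) ∧
      (fun n : ℕ+ => (uMinus : ℕ+ → ℂ) (2 * n + 1)) ~[atTop]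
        (fun n : ℕ+ => -κ * (-1 : ℂ) ^ (n : ℕ) * ((((n : ℕ) : ℝ) ^ (-3 * α / 4) : ℝ) : ℂ) *
          Complex.exp (-β * ((((n : ℕ) : ℝ) ^ (1 - α / 2) / (1 - α / 2) : ℝ) : ℂ))) := by
  have h2 : (0 : ℝ) < 2 ^ α := Real.rpow_pos_of_pos two_pos α
  have hκ0 : κ ≠ 0 := by
    rintro rfl
    have h0 : lam / (2 ^ α * b) ≠ 0 := div_ne_zero hlam.ne' (mul_ne_zero h2.ne' hb)
    exact h0 (by exact_mod_cast (zero_pow two_ne_zero).symm.trans hκ |>.symm)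
  have hβ0 : β ≠ 0 := hβκ ▸ mul_ne_zero (by exact_mod_cast hb) hκ0
  have hβκ' : β * κ = ((lam / 2 ^ α : ℝ) : ℂ) := by
    rw [hβκ, mul_assoc, ← sq, hκ, ← Complex.ofReal_mul]
    congr 1
    field_simp
  obtain ⟨u, hu, hu'⟩ := exists_wkb_solution hα hα' hβ0 hκ0 hβκ hβκ'
  obtain ⟨v, hv, hv'⟩ := exists_wkb_solution (β := -β) (κ := -κ) (b := b) (lam := lam) hα hα'
    (neg_ne_zero.2 hβ0) (neg_ne_zero.2 hκ0) (by rw [hβκ]; ring) (by rw [← hβκ']; ring)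
  have hc : ∀ n : ℕ+, κ * ((((n : ℕ) : ℝ) ^ (-α) : ℝ) : ℂ) ≠ 0 := fun n =>
    mul_ne_zero hκ0 (natCast_rpow_ne_zero _ n.pos)
  have hsign : ∀ n : ℕ+, (-1 : ℂ) ^ (n : ℕ) * (-1 : ℂ) ^ (n : ℕ) = 1 := fun n => by
    rw [← mul_pow]; simp
  have hpow : ∀ n : ℕ+, ((((n : ℕ) : ℝ) ^ (-α / 4) : ℝ) : ℂ) *
      ((((n : ℕ) : ℝ) ^ (-3 * α / 4) : ℝ) : ℂ) = ((((n : ℕ) : ℝ) ^ (-α) : ℝ) : ℂ) := fun n => by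
    rw [← Complex.ofReal_mul, ← Real.rpow_add (by exact_mod_cast n.pos)]
    congr 2
    ring
  have hexp : ∀ x : ℂ, Complex.exp (β * x) * Complex.exp (-β * x) = 1 := fun x => by
    rw [← Complex.exp_add]; simp
  -- In the Casoratian the exponentials cancel, and it is asymptotic to `-2 * κ * n ^ (-α)`.
  have h1 : (fun n : ℕ+ => (u : ℕ+ → ℂ) (2 * n) * (v : ℕ+ → ℂ) (2 * n + 1)) ~[atTop]
      fun n : ℕ+ => -(κ * ((((n : ℕ) : ℝ) ^ (-α) : ℝ) : ℂ)) := by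
    refine (hu.mul hv').congr_right (Eventually.of_forall fun n => ?_)
    simp only [Pi.mul_apply]
    rw [← hpow n]
    generalize ((((n : ℕ) : ℝ) ^ (1 - α / 2) / (1 - α / 2) : ℝ) : ℂ) = x
    linear_combination (-κ * ((((n : ℕ) : ℝ) ^ (-α / 4) : ℝ) : ℂ) *
      ((((n : ℕ) : ℝ) ^ (-3 * α / 4) : ℝ) : ℂ)) *
      (hsign n * Complex.exp (β * x) * Complex.exp (-β * x) + hexp x)
  have h3 : (fun n : ℕ+ => (v : ℕ+ → ℂ) (2 * n) * (u : ℕ+ → ℂ) (2 * n + 1)) ~[atTop]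
      fun n : ℕ+ => κ * ((((n : ℕ) : ℝ) ^ (-α) : ℝ) : ℂ) := by
    refine (hv.mul hu').congr_right (Eventually.of_forall fun n => ?_)
    simp only [Pi.mul_apply]
    rw [← hpow n]
    generalize ((((n : ℕ) : ℝ) ^ (1 - α / 2) / (1 - α / 2) : ℝ) : ℂ) = x
    linear_combination (κ * ((((n : ℕ) : ℝ) ^ (-α / 4) : ℝ) : ℂ) *
      ((((n : ℕ) : ℝ) ^ (-3 * α / 4) : ℝ) : ℂ)) *
      (hsign n * Complex.exp (β * x) * Complex.exp (-β * x) + hexp x)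
  -- Vanishing of the determinant would make `2 * κ * n ^ (-α)` at most half its own size.
  have h4 := (h1.isLittleO.of_neg_right.sub h3.isLittleO).def one_pos
  obtain ⟨n, hn⟩ := h4.exists
  have hdet : (u : ℕ+ → ℂ) (2 * n) * (v : ℕ+ → ℂ) (2 * n + 1) -
      (v : ℕ+ → ℂ) (2 * n) * (u : ℕ+ → ℂ) (2 * n + 1) ≠ 0 := by
    intro h0
    have h5 : 0 < ‖κ * ((((n : ℕ) : ℝ) ^ (-α) : ℝ) : ℂ)‖ := norm_pos_iff.2 (hc n)
    have h6 : ((u : ℕ+ → ℂ) (2 * n) * (v : ℕ+ → ℂ) (2 * n + 1) -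
        -(κ * ((((n : ℕ) : ℝ) ^ (-α) : ℝ) : ℂ))) -
        ((v : ℕ+ → ℂ) (2 * n) * (u : ℕ+ → ℂ) (2 * n + 1) -
        κ * ((((n : ℕ) : ℝ) ^ (-α) : ℝ) : ℂ)) =
        2 * (κ * ((((n : ℕ) : ℝ) ^ (-α) : ℝ) : ℂ)) := by
      linear_combination h0
    simp only [Pi.sub_apply] at hn
    rw [h6, norm_mul] at hn
    norm_num at hn h5
    linarith
  obtain ⟨hli, hspan⟩ := basis_of_det_ne_zero u v hdet
  exact ⟨u, v, hli, hspan, hu, hv, hu', hv'⟩
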